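/- Let $(\Sigma,\partial)$ be a differential field of characteristic $0$ whose field of constants $\mathbf{C}=\{a\in\Sigma\mid\partial(a)=0\}$ is algebraically closed, and let $\Sigma[\partial]$ be the ring of ordinary differential operators with coefficients in $\Sigma$ (so $\partial a=a\partial+\partial(a)$ for $a\in\Sigma$). Let $L\in\Sigma[\partial]$ be an operator of order $3$ with $L\notin\mathbf{C}[\partial]$ and with nontrivial centralizer, i.e. $\mathcal{Z}(L)=\{A\in\Sigma[\partial]\mid LA=AL\}\neq\mathbf{C}[L]$. Then $\mathcal{Z}(L)$ has a basis of the form $\{1,A_1,A_2\}$ as a $\mathbf{C}[L]$-module. For every such basis, let $e_L:\mathbf{C}[\lambda,\mu_1,\mu_2]\to\Sigma[\partial]$ be the $\mathbf{C}$-linear map with $e_L(\lambda^{\alpha_0}\mu_1^{\alpha_1}\mu_2^{\alpha_2})=L^{\alpha_0}A_1^{\alpha_1}A_2^{\alpha_2}$, let $\mathtt{BC}(L)=\{g\in\mathbf{C}[\lambda,\mu_1,\mu_2]\mid e_L(g)=0\}$, and let $\varepsilon_L:\Sigma[\lambda,\mu_1,\mu_2]\to\Sigma[\partial]$ be the $\Sigma$-linear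 map with $\varepsilon_L(\lambda^{\alpha_0}\mu_1^{\alpha_1}\mu_2^{\alpha_2})=L^{\alpha_0}A_1^{\alpha_1}A_2^{\alpha_2}$. Extend $\partial$ to $\Sigma[\lambda,\mu_1,\mu_2]$ by $\partial(\lambda)=\partial(\mu_1)=\partial(\mu_2)=0$, and let $[\mathtt{BC}(L)]$ be the differential ideal (ideal stable under $\partial$) of $\Sigma[\lambda,\mu_1,\mu_2]$ generated by $\mathtt{BC}(L)$. Then: 1. $e_L$ is a ring homomorphism, so that $\mathtt{BC}(L)$ is its kernel. 2. $[\mathtt{BC}(L)]$ coincides with the ideal of $\Sigma[\lambda,\mu_1,\mu_2]$ generated by $\mathtt{BC}(L)$; it is a differential ideal, and it is prime. 3. $\ker(\varepsilon_L)=[\mathtt{BC}(L)]$. 4. $\Sigma[\Gamma]=\Sigma[\lambda,\mu_1,\mu_2]/[\mathtt{BC}(L)]$ is an integral domain, and there is a unique derivation on $\Sigma[\Gamma]$ with $q+[\mathtt{BC}(L)]\mapsto\partial(q)+[\mathtt{BC}(L)]$ for all $q\in\Sigma[\lambda,\mu_1,\mu_2]$. 5. The ring of fractions $\Sigma(\Gamma)$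 of $\Sigma[\Gamma]$ is a field, and the derivation of $\Sigma[\Gamma]$ extends uniquely to a derivation of $\Sigma(\Gamma)$. -/

import Mathlib

open scoped Differential

/-- The field of constants `{x ∈ K | x′ = 0}` of a differential field `K`. -/
def constants (K : Type*) [Field K] [Differential K] : Subfield K where
  carrier := {x | x′ = 0}
  zero_mem' := by simp
  one_mem' := by simp
  add_mem' {a b} ha hb := by
    simp only [Set.mem_ofPred_eq] at *
    simp [ha, hb]
  mul_mem' {a b} ha hb := by
    simp only [Set.mem_ofPred_eq] at *
    simp [ha, hb]
  neg_mem' {a} ha := by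
    simp only [Set.mem_ofPred_eq] at *
    simp [ha]
  inv_mem' a ha := by
    simp only [Set.mem_ofPred_eq] at *
    rcases eq_or_ne a 0 with rfl | h
    · simp
    · have h1 : (a * a⁻¹)′ = 0 := by rw [mul_inv_cancel₀ h]; simp
      rw [Derivation.leibniz, ha, smul_zero, add_zero, smul_eq_mul] at h1
      exact (mul_eq_zero.mp h1).resolve_left h

/-- The differential operators `∑ aᵢ ∂ⁱ` with coefficients in `K`, written with the coefficients
on the left. As a left `K`-vector space this is `K[X]`, with `Xⁱ` standing for `∂ⁱ`; the
multiplication, defined below, is the one with `∂ a = a ∂ + a′`. -/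
def DiffOp (K : Type*) [Field K] [Differential K] : Type _ := Polynomial K

namespace DiffOp

variable {K : Type*} [Field K] [Differential K]

noncomputable instance : AddCommGroup (DiffOp K) := inferInstanceAs (AddCommGroup (Polynomial K))

noncomputable instance : Module K (DiffOp K) := inferInstanceAs (Module K (Polynomial K))

/-- The operator `a ∂ⁱ`. -/
noncomputable def monomial (i : ℕ) (a : K) : DiffOp K := Polynomial.monomial i a

/-- The coefficient of `∂ⁱ`. -/
def coeff (P : DiffOp K) (i : ℕ) : K := Polynomial.coeff P i

/-- The order of an operator, with the convention that the zero operator has order `⊥ = -∞`. -/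
def order (P : DiffOp K) : WithBot ℕ := Polynomial.degree P

/-- Two operators with the same coefficients are equal. -/
theorem ext_coeff {P Q : DiffOp K} (h : ∀ i, P.coeff i = Q.coeff i) : P = Q := Polynomial.ext h

theorem coeff_add (P Q : DiffOp K) (i : ℕ) : (P + Q).coeff i = P.coeff i + Q.coeff i :=
  Polynomial.coeff_add P Q i

theorem coeff_smul (a : K) (P : DiffOp K) (i : ℕ) : (a • P).coeff i = a * P.coeff i :=
  Polynomial.coeff_smul a P i

theorem coeff_monomial (i : ℕ) (a : K) (j : ℕ) :
    (monomial i a).coeff j = if i = j then a else 0 := Polynomial.coeff_monomial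

theorem monomial_add (i : ℕ) (a b : K) : monomial i (a + b) = monomial i a + monomial i b :=
  (Polynomial.monomial i).map_add a b

theorem monomial_zero (i : ℕ) : monomial i (0 : K) = 0 := Polynomial.monomial_zero_right i

theorem smul_monomial (i : ℕ) (a b : K) : a • monomial i b = monomial i (a * b) :=
  Polynomial.smul_monomial a i b

@[elab_as_elim]
theorem induction_on {p : DiffOp K → Prop} (P : DiffOp K)
    (add : ∀ P Q, p P → p Q → p (P + Q)) (mono : ∀ i a, p (monomial i a)) : p P :=
  Polynomial.induction_on' P add mono

/-- Multiplication by `∂` on the left: `∑ aᵢ ∂ⁱ ↦ ∑ (aᵢ ∂ⁱ⁺¹ + aᵢ′ ∂ⁱ)`. -/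
noncomputable def leftD : Module.End ℤ (DiffOp K) :=
  AddMonoidHom.toIntLinearMap
    { toFun := fun P => Polynomial.sum P fun i a => monomial (i + 1) a + monomial i a′
      map_zero' := Polynomial.sum_zero_index _
      map_add' := fun P Q => by
        refine Polynomial.sum_add_index P Q _ (fun i => ?_) (fun i a b => ?_)
        · rw [map_zero, monomial_zero, monomial_zero, add_zero]
        · rw [map_add, monomial_add, monomial_add]; abel }

theorem leftD_monomial (i : ℕ) (a : K) :
    leftD (monomial i a) = monomial (i + 1) a + monomial i a′ :=
  Polynomial.sum_monomial_index (n := i) a (fun i a => monomial (i + 1) a + monomial i a′)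
    (by rw [map_zero, monomial_zero, monomial_zero, add_zero])

/-- Leibniz rule: `∂ (a P) = a (∂ P) + a′ P`. -/
theorem leftD_smul (a : K) (P : DiffOp K) : leftD (a • P) = a • leftD P + a′ • P := by
  induction P using induction_on with
  | add P Q hP hQ => rw [smul_add, map_add, hP, hQ, map_add, smul_add, smul_add]; abel
  | mono i b =>
    rw [smul_monomial, leftD_monomial, leftD_monomial, smul_add, smul_monomial, smul_monomial,
      smul_monomial, add_assoc, ← monomial_add, Derivation.leibniz, smul_eq_mul, smul_eq_mul,
      mul_comm b]

/-- Multiplication by the function `a` on the left. -/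
noncomputable def leftC : K →+ Module.End ℤ (DiffOp K) where
  toFun a :=
    AddMonoidHom.toIntLinearMap
      { toFun := fun P => a • P, map_zero' := smul_zero a, map_add' := smul_add a }
  map_zero' := by ext P; exact zero_smul K P
  map_add' a b := by ext P; exact add_smul a b P

theorem leftC_apply (a : K) (P : DiffOp K) : leftC a P = a • P := rfl

/-- Multiplication by `∑ aᵢ ∂ⁱ` on the left: `Q ↦ ∑ aᵢ (∂ⁱ Q)`. -/
noncomputable def leftMul : DiffOp K →+ Module.End ℤ (DiffOp K) where
  toFun P := Polynomial.sum P fun i a => leftC a * leftD ^ i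
  map_zero' := Polynomial.sum_zero_index _
  map_add' P Q :=
    Polynomial.sum_add_index P Q _ (fun i => by simp) (fun i a b => by rw [map_add, add_mul])

theorem leftMul_monomial (i : ℕ) (a : K) :
    leftMul (monomial i a) = leftC a * leftD ^ i :=
  Polynomial.sum_monomial_index (n := i) a (fun i a => leftC a * leftD ^ i)
    (by rw [map_zero, zero_mul])

noncomputable instance : Mul (DiffOp K) := ⟨fun P Q => leftMul P Q⟩

noncomputable instance : One (DiffOp K) := ⟨monomial 0 1⟩

theorem mul_def (P Q : DiffOp K) : P * Q = leftMul P Q := rfl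

theorem one_def : (1 : DiffOp K) = monomial 0 1 := rfl

theorem leftMul_smul (a : K) (P : DiffOp K) : leftMul (a • P) = leftC a * leftMul P := by
  induction P using induction_on with
  | add P Q hP hQ => rw [smul_add, map_add, hP, hQ, map_add, mul_add]
  | mono i b =>
    rw [smul_monomial, leftMul_monomial, leftMul_monomial, ← mul_assoc]
    congr 1
    ext P
    simp only [Module.End.mul_apply, leftC_apply, mul_smul]

theorem leftMul_leftD (P : DiffOp K) : leftMul (leftD P) = leftD * leftMul P := by
  induction P using induction_on with
  | add P Q hP hQ => rw [map_add, map_add, hP, hQ, map_add, mul_add]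
  | mono i a =>
    rw [leftD_monomial, map_add, leftMul_monomial, leftMul_monomial, leftMul_monomial]
    ext P
    simp only [LinearMap.add_apply, Module.End.mul_apply, leftC_apply, leftD_smul, pow_succ']

theorem leftMul_mul (P Q : DiffOp K) : leftMul (P * Q) = leftMul P * leftMul Q := by
  induction P using induction_on with
  | add P P' hP hP' =>
    rw [mul_def] at hP hP' ⊢
    rw [map_add, LinearMap.add_apply, map_add, add_mul, hP, hP']
  | mono i a =>
    have key : ∀ n : ℕ, leftMul ((leftD ^ n) Q) = leftD ^ n * leftMul Q := by
      intro n
      induction n with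
      | zero => simp
      | succ n ih => rw [pow_succ', Module.End.mul_apply, leftMul_leftD, ih, mul_assoc]
    rw [mul_def, leftMul_monomial, Module.End.mul_apply, leftC_apply, leftMul_smul, key, mul_assoc]

theorem leftMul_one : leftMul (1 : DiffOp K) = 1 := by
  rw [one_def, leftMul_monomial, pow_zero, mul_one]
  ext P
  simp only [leftC_apply, one_smul, Module.End.one_apply]

theorem leftD_pow_one (i : ℕ) : (leftD ^ i) (1 : DiffOp K) = monomial i 1 := by
  induction i with
  | zero => rfl
  | succ i ih =>
    rw [pow_succ', Module.End.mul_apply, ih, leftD_monomial, Derivation.map_one_eq_zero, monomial_zero, add_zero]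

/-- The ring `K[∂]`. -/
noncomputable instance : Ring (DiffOp K) :=
  { (inferInstance : AddCommGroup (DiffOp K)), (inferInstance : Mul (DiffOp K)),
    (inferInstance : One (DiffOp K)) with
    left_distrib := fun P Q R => map_add (leftMul P) Q R
    right_distrib := fun P Q R => by simp only [mul_def, map_add, LinearMap.add_apply]
    zero_mul := fun P => by simp only [mul_def, map_zero, LinearMap.zero_apply]
    mul_zero := fun P => map_zero (leftMul P)
    mul_assoc := fun P Q R => by
      rw [mul_def, leftMul_mul, Module.End.mul_apply]; rfl
    one_mul := fun P => by rw [mul_def, leftMul_one]; rfl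
    mul_one := fun P => by
      induction P using induction_on with
      | add P Q hP hQ => rw [mul_def] at *; rw [map_add, LinearMap.add_apply, hP]; rw [hQ]
      | mono i a =>
        rw [mul_def, leftMul_monomial, Module.End.mul_apply, leftD_pow_one, leftC_apply,
          smul_monomial, mul_one] }

/-- The derivation `∂` as an operator. -/
noncomputable def D : DiffOp K := monomial 1 1

/-- The function `a` as an operator of order zero. -/
noncomputable def func (a : K) : DiffOp K := monomial 0 a

theorem func_mul (a : K) (P : DiffOp K) : func a * P = a • P := by
  rw [func, mul_def, leftMul_monomial, pow_zero, mul_one, leftC_apply]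

/-- The commutation rule of `K[∂]`. -/
theorem D_mul_func (a : K) : D * func a = func a * D + func (a′ : K) := by
  rw [func_mul, D, mul_def, leftMul_monomial, pow_one, Module.End.mul_apply, leftC_apply, one_smul,
    func, leftD_monomial, smul_monomial, mul_one]
  rfl

theorem monomial_eq (i : ℕ) (a : K) : monomial i a = func a * D ^ i := by
  have h : ∀ n : ℕ, (D : DiffOp K) ^ n = monomial n 1 := by
    intro n
    induction n with
    | zero => rfl
    | succ n ih =>
      rw [pow_succ', ih, D, mul_def, leftMul_monomial, pow_one, Module.End.mul_apply, leftC_apply,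
        one_smul, leftD_monomial, Derivation.map_one_eq_zero, monomial_zero, add_zero]
  rw [h, func_mul, smul_monomial, mul_one]

theorem smul_mul_left (a : K) (P Q : DiffOp K) : (a • P) * Q = a • (P * Q) := by
  rw [mul_def, leftMul_smul]; rfl

theorem mul_const_smul (c : constants K) (P Q : DiffOp K) :
    P * ((c : K) • Q) = (c : K) • (P * Q) := by
  have hc : (c : K)′ = 0 := c.2
  induction P using induction_on with
  | add P P' hP hP' => rw [add_mul, hP, hP', add_mul, smul_add]
  | mono i a =>
    rw [mul_def, mul_def, leftMul_monomial, Module.End.mul_apply, Module.End.mul_apply, leftC_apply,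
      leftC_apply, smul_comm (c : K) a]
    congr 1
    induction i generalizing Q with
    | zero => rfl
    | succ i ih =>
      rw [pow_succ, Module.End.mul_apply, Module.End.mul_apply, leftD_smul, hc, zero_smul, add_zero]
      exact ih _

/-- `K[∂]` is an algebra over the constants, which commute with every operator. -/
noncomputable instance : Algebra (constants K) (DiffOp K) :=
  Algebra.ofModule (fun c P Q => smul_mul_left (c : K) P Q) mul_const_smul

/-- The subset `C[∂]` of operators with constant coefficients. -/
def HasConstCoeffs (P : DiffOp K) : Prop := ∀ i, P.coeff i ∈ constants K

/-- The ring `C[L]` of polynomials in `L` with constant coefficients. -/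
noncomputable def constPoly (L : DiffOp K) : Subalgebra (constants K) (DiffOp K) :=
  Algebra.adjoin (constants K) {L}

/-- The centralizer `Z(L) = {A | L A = A L}` of `L` in `K[∂]`. -/
noncomputable def centralizer (L : DiffOp K) : Subalgebra (constants K) (DiffOp K) :=
  Subalgebra.centralizer (constants K) {L}

/-- `{1, A₁, A₂}` is a basis of the centralizer of `L` as a (left) `C[L]`-module. -/
structure IsCentralizerBasis (L A₁ A₂ : DiffOp K) : Prop where
  linearIndependent : LinearIndependent (constPoly L) ![1, A₁, A₂]
  span_eq : (Submodule.span (constPoly L) (Set.range ![1, A₁, A₂]) : Set (DiffOp K)) =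
    centralizer L

/-- The map `e_L : C[λ, μ₁, μ₂] → K[∂]`, `g ↦ g(L, A₁, A₂)`, sending the monomial
`λ^α₀ μ₁^α₁ μ₂^α₂` to `L^α₀ A₁^α₁ A₂^α₂`. Here `λ, μ₁, μ₂` are the variables `0, 1, 2`. -/
noncomputable def eval (L A₁ A₂ : DiffOp K) :
    MvPolynomial (Fin 3) (constants K) →ₗ[constants K] DiffOp K :=
  (MvPolynomial.basisMonomials (Fin 3) (constants K)).constr (constants K)
    fun α => L ^ α 0 * A₁ ^ α 1 * A₂ ^ α 2

/-- The `K`-linear map `ε_L : K[λ, μ₁, μ₂] → K[∂]`, sending the monomial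
`λ^α₀ μ₁^α₁ μ₂^α₂` to `L^α₀ A₁^α₁ A₂^α₂`. -/
noncomputable def evalK (L A₁ A₂ : DiffOp K) : MvPolynomial (Fin 3) K →ₗ[K] DiffOp K :=
  (MvPolynomial.basisMonomials (Fin 3) K).constr K fun α => L ^ α 0 * A₁ ^ α 1 * A₂ ^ α 2

/-- The Burchnall–Chaundy polynomials: `BC(L) = {g ∈ C[λ, μ₁, μ₂] | g(L, A₁, A₂) = 0}`. -/
def BC (L A₁ A₂ : DiffOp K) : Set (MvPolynomial (Fin 3) (constants K)) :=
  {g | eval L A₁ A₂ g = 0}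

end DiffOp

theorem coeff_sum_monomial_deriv {K : Type*} [Field K] [Differential K]
    (p : MvPolynomial (Fin 3) K) (m : Fin 3 →₀ ℕ) :
    (∑ n ∈ p.support, MvPolynomial.monomial n (p.coeff n)′).coeff m = (p.coeff m)′ := by
  classical
  rw [MvPolynomial.coeff_sum]
  simp only [MvPolynomial.coeff_monomial, Finset.sum_ite_eq', MvPolynomial.mem_support_iff]
  split_ifs with h
  · rfl
  · rw [not_not.mp h, map_zero]

/-- Coefficientwise differentiation `∑ aₘ m ↦ ∑ aₘ′ m` of `K[λ, μ₁, μ₂]`, as an additive map. -/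
noncomputable def polyDerivAux (K : Type*) [Field K] [Differential K] :
    MvPolynomial (Fin 3) K →+ MvPolynomial (Fin 3) K where
  toFun p := ∑ m ∈ p.support, MvPolynomial.monomial m (p.coeff m)′
  map_zero' := by simp
  map_add' p q := by
    ext m
    rw [MvPolynomial.coeff_add, coeff_sum_monomial_deriv, coeff_sum_monomial_deriv,
      coeff_sum_monomial_deriv, MvPolynomial.coeff_add, map_add]

theorem coeff_polyDerivAux {K : Type*} [Field K] [Differential K] (p : MvPolynomial (Fin 3) K)
    (m : Fin 3 →₀ ℕ) : (polyDerivAux K p).coeff m = (p.coeff m)′ :=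
  coeff_sum_monomial_deriv p m

/-- The derivation of `K[λ, μ₁, μ₂]` extending that of `K` with `λ, μ₁, μ₂` constant: it
differentiates every coefficient. -/
noncomputable def polyDeriv (K : Type*) [Field K] [Differential K] :
    Derivation ℤ (MvPolynomial (Fin 3) K) (MvPolynomial (Fin 3) K) :=
  Derivation.mk' (polyDerivAux K).toIntLinearMap (fun p q => by
    classical
    ext m
    rw [smul_eq_mul, smul_eq_mul, mul_comm q]
    simp only [AddMonoidHom.coe_toIntLinearMap, MvPolynomial.coeff_add, coeff_polyDerivAux,
      MvPolynomial.coeff_mul, map_sum, Derivation.leibniz, Finset.sum_add_distrib, smul_eq_mul]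
    congr 1
    exact Finset.sum_congr rfl fun x _ => mul_comm _ _)

theorem coeff_polyDeriv {K : Type*} [Field K] [Differential K] (p : MvPolynomial (Fin 3) K)
    (m : Fin 3 →₀ ℕ) : (polyDeriv K p).coeff m = (p.coeff m)′ :=
  coeff_polyDerivAux p m

/-- An ideal of `K[λ, μ₁, μ₂]` is a differential ideal if it is stable under the derivation. -/
def IsDifferentialIdeal {K : Type*} [Field K] [Differential K]
    (I : Ideal (MvPolynomial (Fin 3) K)) : Prop := ∀ f ∈ I, polyDeriv K f ∈ I

/-- The differential ideal `[S]` of `K[λ, μ₁, μ₂]` generated by `S`: the smallest differential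
ideal that contains `S`. -/
noncomputable def differentialSpan {K : Type*} [Field K] [Differential K] (S : Set (MvPolynomial (Fin 3) K)) :
    Ideal (MvPolynomial (Fin 3) K) :=
  sInf {I | S ⊆ I ∧ IsDifferentialIdeal I}

namespace DiffOp

variable {K : Type*} [Field K] [Differential K]

/-- `BC(L)` regarded inside `K[λ, μ₁, μ₂]`. -/
noncomputable def BCExt (L A₁ A₂ : DiffOp K) : Set (MvPolynomial (Fin 3) K) :=
  MvPolynomial.map (constants K).subtype '' BC L A₁ A₂

/-- The differential ideal `[BC(L)]` of `K[λ, μ₁, μ₂]`. -/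
noncomputable def BCIdeal (L A₁ A₂ : DiffOp K) : Ideal (MvPolynomial (Fin 3) K) :=
  differentialSpan (BCExt L A₁ A₂)

/-- The ring `K[Γ] = K[λ, μ₁, μ₂] / [BC(L)]`. -/
abbrev CurveRing (L A₁ A₂ : DiffOp K) : Type _ := MvPolynomial (Fin 3) K ⧸ BCIdeal L A₁ A₂

/-- The ring of fractions `K(Γ)` of `K[Γ]`. -/
abbrev CurveField (L A₁ A₂ : DiffOp K) : Type _ := FractionRing (CurveRing L A₁ A₂)

end DiffOp

/-! ### Orders and leading coefficients of differential operators. -/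

namespace DiffOp

variable {K : Type*} [Field K] [Differential K]

/-! Everything rests on orders. If `B` commutes with `L`, comparing the two top coefficients of `L *
B` and `B * L` gives a first order linear equation for the leading coefficient of `B` that depends
only on `L` and the order of `B`. So two commuting operators of equal order have proportional
leading coefficients, with a constant ratio: graded by order, the centralizer has pieces of
dimension at most one over the constants (`exists_const_ord_sub_lt`), and a subspace of it that
attains every order is all of it (`centralizer_le_of_forall_ord`).

Since nonzero elements of C[L] have order divisible by 3, a nontrivial centralizer contains an order
prime to 3, hence every residue mod 3, and elements of minimal order in the classes 1 and 2 complete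
1 to a basis. The rank being 3, every element is a fraction over C[L] of a polynomial in one fixed
operator, so the centralizer is commutative (`commute_of_mem_centralizer`) and `e_L` is
multiplicative.

For each order attained by `e_L`, pick a polynomial with constant coefficients attaining it. These
span C[λ,μ₁,μ₂] modulo BC(L) over the constants, hence Σ[λ,μ₁,μ₂] modulo (BC(L)) over Σ
(`exists_span_eval_ord`). Their values have distinct orders, so are independent over Σ: this gives
ker(`ε_L`) = (BC(L)). The map `ε_L` is not multiplicative, but the top coefficient of a product
behaves as if it were, and this gives primality. Finally (BC(L)) is stable under ∂ because its
generators have constant coefficients. -/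

theorem coeff_zero (i : ℕ) : (0 : DiffOp K).coeff i = 0 := Polynomial.coeff_zero i

theorem coeff_sub (P Q : DiffOp K) (i : ℕ) : (P - Q).coeff i = P.coeff i - Q.coeff i :=
  Polynomial.coeff_sub P Q i

theorem coeff_sum {ι : Type*} (s : Finset ι) (P : ι → DiffOp K) (i : ℕ) :
    (∑ j ∈ s, P j).coeff i = ∑ j ∈ s, (P j).coeff i :=
  Polynomial.finsetSum_coeff s P i

/-- The order of a nonzero operator as a natural number. -/
def ord (P : DiffOp K) : ℕ := Polynomial.natDegree P

/-- The leading coefficient of an operator. -/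
def lc (P : DiffOp K) : K := P.coeff P.ord

theorem lc_ne_zero {P : DiffOp K} (h : P ≠ 0) : P.lc ≠ 0 :=
  Polynomial.leadingCoeff_ne_zero.mpr h

theorem coeff_eq_zero_of_ord_lt {P : DiffOp K} {i : ℕ} (h : P.ord < i) : P.coeff i = 0 :=
  Polynomial.coeff_eq_zero_of_natDegree_lt h

theorem le_ord_of_coeff_ne_zero {P : DiffOp K} {i : ℕ} (h : P.coeff i ≠ 0) : i ≤ P.ord :=
  Polynomial.le_natDegree_of_ne_zero h

theorem ord_eq_of_coeff {P : DiffOp K} {n : ℕ} (h : P.coeff n ≠ 0)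
    (h' : ∀ i, n < i → P.coeff i = 0) : P.ord = n :=
  le_antisymm (not_lt.mp fun hn =>
    lc_ne_zero (P := P) (by rintro rfl; exact h (coeff_zero n)) (h' _ hn))
    (le_ord_of_coeff_ne_zero h)

theorem ne_zero_of_coeff_ne_zero {P : DiffOp K} {n : ℕ} (h : P.coeff n ≠ 0) : P ≠ 0 := by
  rintro rfl
  exact h (coeff_zero n)

theorem ord_smul {c : K} (hc : c ≠ 0) (P : DiffOp K) : (c • P).ord = P.ord :=
  Polynomial.natDegree_smul P hc

theorem coeff_leftD_succ (Q : DiffOp K) (k : ℕ) :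
    (leftD Q).coeff (k + 1) = Q.coeff k + (Q.coeff (k + 1))′ := by
  induction Q using induction_on with
  | add P Q hP hQ => rw [map_add, coeff_add, hP, hQ, coeff_add, coeff_add, map_add]; abel
  | mono i a =>
    rw [leftD_monomial, coeff_add, coeff_monomial, coeff_monomial, coeff_monomial, coeff_monomial]
    split_ifs <;> simp_all

theorem coeff_leftD_pow_eq_zero {Q : DiffOp K} {m : ℕ} (hQ : ∀ k, m < k → Q.coeff k = 0) (i : ℕ) :
    ∀ k, m + i < k → ((leftD ^ i) Q).coeff k = 0 := by
  induction i with
  | zero => exact hQ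
  | succ i ih =>
    intro k hk
    obtain ⟨k, rfl⟩ : ∃ j, k = j + 1 := ⟨k - 1, by omega⟩
    rw [pow_succ', Module.End.mul_apply, coeff_leftD_succ, ih k (by omega), ih (k + 1) (by omega),
      map_zero, add_zero]

theorem coeff_leftD_pow_top {Q : DiffOp K} {m : ℕ} (hQ : ∀ k, m < k → Q.coeff k = 0) (i : ℕ) :
    ((leftD ^ i) Q).coeff (m + i) = Q.coeff m := by
  induction i with
  | zero => rfl
  | succ i ih =>
    rw [pow_succ', Module.End.mul_apply, ← add_assoc, coeff_leftD_succ, ih,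
      coeff_leftD_pow_eq_zero hQ i _ (by omega), map_zero, add_zero]

theorem coeff_leftD_pow_subtop {Q : DiffOp K} {m : ℕ} (hQ : ∀ k, m + 1 < k → Q.coeff k = 0)
    (i : ℕ) : ((leftD ^ i) Q).coeff (m + i) = Q.coeff m + i * (Q.coeff (m + 1))′ := by
  induction i with
  | zero => simp
  | succ i ih =>
    rw [pow_succ', Module.End.mul_apply, ← add_assoc, coeff_leftD_succ, ih,
      show m + i + 1 = m + 1 + i by omega, coeff_leftD_pow_top hQ]
    push_cast
    ring

theorem coeff_mul (P Q : DiffOp K) {n : ℕ} (hP : ∀ k, n < k → P.coeff k = 0) (k : ℕ) :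
    (P * Q).coeff k = ∑ i ∈ Finset.range (n + 1), P.coeff i * ((leftD ^ i) Q).coeff k := by
  have hsum : leftMul P = ∑ i ∈ Finset.range (n + 1), leftC (P.coeff i) * leftD ^ i :=
    Polynomial.sum_over_range' P (f := fun i a => leftC a * leftD ^ i)
      (fun i => by rw [map_zero, zero_mul]) (n + 1)
      (Nat.lt_succ_of_le (Polynomial.natDegree_le_iff_coeff_eq_zero.mpr hP))
  rw [mul_def, hsum, LinearMap.sum_apply, coeff_sum]
  exact Finset.sum_congr rfl fun i _ => coeff_smul _ _ _

theorem coeff_mul_eq_zero {P Q : DiffOp K} {n m : ℕ} (hP : ∀ k, n < k → P.coeff k = 0)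
    (hQ : ∀ k, m < k → Q.coeff k = 0) {k : ℕ} (hk : n + m < k) : (P * Q).coeff k = 0 := by
  rw [coeff_mul P Q hP]
  refine Finset.sum_eq_zero fun i hi => ?_
  rw [Finset.mem_range] at hi
  rw [coeff_leftD_pow_eq_zero hQ i k (by omega), mul_zero]

theorem coeff_mul_top {P Q : DiffOp K} {n m : ℕ} (hP : ∀ k, n < k → P.coeff k = 0)
    (hQ : ∀ k, m < k → Q.coeff k = 0) : (P * Q).coeff (n + m) = P.coeff n * Q.coeff m := by
  rw [coeff_mul P Q hP, Finset.sum_range_succ, add_comm n m, coeff_leftD_pow_top hQ]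
  refine add_eq_right.mpr (Finset.sum_eq_zero fun i hi => ?_)
  rw [Finset.mem_range] at hi
  rw [coeff_leftD_pow_eq_zero hQ i _ (by omega), mul_zero]

/-- The coefficient just below the top is the first one that sees noncommutativity, through the
derivative of the top coefficient of `Q`. -/
theorem coeff_mul_subtop {P Q : DiffOp K} {n m : ℕ} (hP : ∀ k, n + 1 < k → P.coeff k = 0)
    (hQ : ∀ k, m + 1 < k → Q.coeff k = 0) :
    (P * Q).coeff (n + m + 1) = P.coeff (n + 1) * Q.coeff m +
      (n + 1) * P.coeff (n + 1) * (Q.coeff (m + 1))′ + P.coeff n * Q.coeff (m + 1) := by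
  rw [coeff_mul P Q hP, Finset.sum_range_succ, Finset.sum_range_succ,
    show n + m + 1 = m + (n + 1) by omega, coeff_leftD_pow_subtop hQ,
    show m + (n + 1) = m + 1 + n by omega, coeff_leftD_pow_top hQ, Finset.sum_eq_zero]
  · push_cast
    ring
  · intro i hi
    rw [Finset.mem_range] at hi
    rw [coeff_leftD_pow_eq_zero hQ i _ (by omega), mul_zero]

theorem coeff_mul_ord (P Q : DiffOp K) : (P * Q).coeff (P.ord + Q.ord) = P.lc * Q.lc :=
  coeff_mul_top (fun _ => coeff_eq_zero_of_ord_lt) (fun _ => coeff_eq_zero_of_ord_lt)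

theorem ord_mul {P Q : DiffOp K} (hP : P ≠ 0) (hQ : Q ≠ 0) : (P * Q).ord = P.ord + Q.ord :=
  ord_eq_of_coeff (by rw [coeff_mul_ord]; exact mul_ne_zero (lc_ne_zero hP) (lc_ne_zero hQ))
    fun _ => coeff_mul_eq_zero (fun _ => coeff_eq_zero_of_ord_lt) (fun _ => coeff_eq_zero_of_ord_lt)

instance : NoZeroDivisors (DiffOp K) where
  eq_zero_or_eq_zero_of_mul_eq_zero {P Q} h := by
    by_contra! hc
    have := coeff_mul_ord P Q
    rw [h, coeff_zero] at this
    exact mul_ne_zero (lc_ne_zero hc.1) (lc_ne_zero hc.2) this.symm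

instance : Nontrivial (DiffOp K) :=
  ⟨⟨1, 0, ne_zero_of_coeff_ne_zero (n := 0) (by rw [one_def, coeff_monomial]; simp)⟩⟩

instance : IsDomain (DiffOp K) := NoZeroDivisors.to_isDomain _

theorem ord_one : (1 : DiffOp K).ord = 0 := Polynomial.natDegree_one

theorem ord_pow {P : DiffOp K} (hP : P ≠ 0) (n : ℕ) : (P ^ n).ord = n * P.ord := by
  induction n with
  | zero => rw [pow_zero, ord_one, zero_mul]
  | succ n ih => rw [pow_succ, ord_mul (pow_ne_zero n hP) hP, ih]; ring

/-- In a nonempty sum of nonzero operators of pairwise distinct orders nothing cancels. -/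
theorem exists_ord_sum_eq {ι : Type*} {s : Finset ι} (hs : s.Nonempty) {P : ι → DiffOp K}
    (h0 : ∀ i ∈ s, P i ≠ 0) (hinj : Set.InjOn (fun i => (P i).ord) s) :
    ∃ i ∈ s, ∑ j ∈ s, P j ≠ 0 ∧ (∑ j ∈ s, P j).ord = (P i).ord := by
  classical
  obtain ⟨i, hi, hmax⟩ := s.exists_max_image (fun i => (P i).ord) hs
  have hc : (∑ j ∈ s, P j).coeff (P i).ord = (P i).lc := by
    rw [coeff_sum, Finset.sum_eq_single_of_mem i hi]
    · rfl
    · intro j hj hji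
      exact coeff_eq_zero_of_ord_lt
        (lt_of_le_of_ne (hmax j hj) fun h => hji (hinj hj hi h))
  have hne : (∑ j ∈ s, P j).coeff (P i).ord ≠ 0 := hc ▸ lc_ne_zero (h0 i hi)
  refine ⟨i, hi, ne_zero_of_coeff_ne_zero hne, ord_eq_of_coeff hne fun k hk => ?_⟩
  rw [coeff_sum]
  exact Finset.sum_eq_zero fun j hj => coeff_eq_zero_of_ord_lt ((hmax j hj).trans_lt hk)

/-- Operators whose nonzero members have distinct orders can only add up to zero if they all
vanish. -/
theorem eq_zero_of_sum_eq_zero {ι : Type*} {s : Finset ι} {P : ι → DiffOp K}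
    (hinj : ∀ i ∈ s, ∀ j ∈ s, P i ≠ 0 → P j ≠ 0 → (P i).ord = (P j).ord → i = j)
    (h : ∑ i ∈ s, P i = 0) : ∀ i ∈ s, P i = 0 := by
  classical
  by_contra! hne
  obtain ⟨i, hi, hi0⟩ := hne
  rw [← Finset.sum_filter_ne_zero] at h
  obtain ⟨-, -, h', -⟩ := exists_ord_sum_eq (s := s.filter fun i => P i ≠ 0) (P := P)
    ⟨i, by simp [hi, hi0]⟩ (by simp) (by
      intro a ha b hb hab
      simp only [Finset.coe_filter, Set.mem_ofPred_eq] at ha hb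
      exact hinj a ha.1 b hb.1 ha.2 hb.2 hab)
  exact h' h

end DiffOp

/-! ### The centralizer: bases over C[L] and commutativity. -/

namespace DiffOp

variable {K : Type*} [Field K] [Differential K]

theorem mem_centralizer {L A : DiffOp K} : A ∈ L.centralizer ↔ L * A = A * L := by
  rw [centralizer, Subalgebra.mem_centralizer_iff]
  exact ⟨fun h => h L rfl, fun h _ hg => by rw [Set.mem_singleton_iff.mp hg]; exact h⟩

theorem self_mem_centralizer (L : DiffOp K) : L ∈ L.centralizer := mem_centralizer.mpr rfl

theorem mem_constPoly {L P : DiffOp K} :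
    P ∈ L.constPoly ↔ ∃ q : Polynomial (constants K), Polynomial.aeval L q = P := by
  rw [constPoly, Algebra.adjoin_singleton_eq_range_aeval]
  rfl

theorem self_mem_constPoly (L : DiffOp K) : L ∈ L.constPoly :=
  Algebra.subset_adjoin (Set.mem_singleton L)

theorem constPoly_le_centralizer (L : DiffOp K) : L.constPoly ≤ L.centralizer :=
  Algebra.adjoin_le (Set.singleton_subset_iff.mpr (self_mem_centralizer L))

theorem ord_eq_of_order_eq {L : DiffOp K} {n : ℕ} (hL : L.order = n) : L.ord = n :=
  Polynomial.natDegree_eq_of_degree_eq_some hL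

theorem ne_zero_of_ord_eq_three {L : DiffOp K} (hL : L.ord = 3) : L ≠ 0 := by
  rintro rfl
  exact absurd (Polynomial.natDegree_zero.symm.trans hL) (by norm_num)

/-- The leading coefficient of an operator commuting with `L` satisfies a first order equation. -/
theorem deriv_lc_of_mem_centralizer {L B : DiffOp K} (hL : L.ord = 3) (hB : B ∈ L.centralizer)
    {m : ℕ} (hm : B.ord = m + 1) :
    3 * L.lc * (B.lc)′ = (m + 1) * (L.lc)′ * B.lc := by
  have h1 := coeff_mul_subtop (P := L) (Q := B) (n := 2) (m := m)
    (fun k hk => coeff_eq_zero_of_ord_lt (by omega)) fun k hk => coeff_eq_zero_of_ord_lt (by omega)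
  have h2 := coeff_mul_subtop (P := B) (Q := L) (n := m) (m := 2)
    (fun k hk => coeff_eq_zero_of_ord_lt (by omega)) fun k hk => coeff_eq_zero_of_ord_lt (by omega)
  -- The products of top and subtop coefficients are the same for `L * B` and `B * L`; only the
  -- derivative terms survive.
  rw [add_comm m 2, ← mem_centralizer.mp hB, h1] at h2
  rw [lc, lc, hL, hm]
  push_cast at h2
  linear_combination h2

/-- Both leading coefficients solve the same homogeneous first order equation, so their ratio has
derivative zero and serves as `c`. -/
theorem exists_const_ord_sub_lt [CharZero K] {L A B : DiffOp K} (hL : L.ord = 3)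
    (hA : A ∈ L.centralizer) (hB : B ∈ L.centralizer) (hB0 : B ≠ 0)
    (hAB : A.ord = B.ord) :
    ∃ c : constants K, A - c • B = 0 ∨ (A - c • B).ord < A.ord := by
  have hL0 := ne_zero_of_ord_eq_three hL
  -- The equation needs positive order. In order zero, multiply both operators by `L`, and cancel
  -- `L` afterwards.
  wlog hpos : 0 < A.ord generalizing A B
  · rcases eq_or_ne A 0 with rfl | hA0
    · exact ⟨0, Or.inl (by simp)⟩
    obtain ⟨c, hc⟩ := this (A := L * A) (B := L * B) (mul_mem (self_mem_centralizer L) hA)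
      (mul_mem (self_mem_centralizer L) hB) (mul_ne_zero hL0 hB0)
      (by rw [ord_mul hL0 hA0, ord_mul hL0 hB0, hAB]) (by rw [ord_mul hL0 hA0]; omega)
    refine ⟨c, ?_⟩
    rw [← mul_smul_comm, ← mul_sub] at hc
    by_cases h : A - c • B = 0
    · exact Or.inl h
    · rw [ord_mul hL0 h, ord_mul hL0 hA0] at hc
      exact Or.inr (by have := hc.resolve_left (mul_ne_zero hL0 h); omega)
  obtain ⟨m, hm⟩ : ∃ m, A.ord = m + 1 := ⟨A.ord - 1, by omega⟩
  have h1 := deriv_lc_of_mem_centralizer hL hA hm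
  have h2 := deriv_lc_of_mem_centralizer hL hB (hAB ▸ hm)
  have hb := lc_ne_zero hB0
  have hl := lc_ne_zero hL0
  have hc : A.lc / B.lc ∈ constants K := by
    change (A.lc / B.lc)′ = 0
    have : 3 * L.lc * (B.lc * (A.lc)′ - A.lc * (B.lc)′) = 0 := by
      linear_combination B.lc * h1 - A.lc * h2
    have := (mul_eq_zero.mp this).resolve_left (mul_ne_zero three_ne_zero hl)
    rw [Derivation.leibniz_div]
    simp only [smul_eq_mul]
    rw [this, mul_zero]
  refine ⟨⟨_, hc⟩, or_iff_not_imp_left.mpr fun hne => ?_⟩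
  have hcoeff : ∀ k, A.ord ≤ k →
      (A - (⟨_, hc⟩ : constants K) • B).coeff k = 0 := by
    intro k hk
    have hs : ((⟨_, hc⟩ : constants K) • B).coeff k = A.lc / B.lc * B.coeff k := coeff_smul _ _ _
    rw [coeff_sub, hs]
    rcases hk.eq_or_lt with rfl | hk
    · rw [show B.coeff A.ord = B.lc by rw [hAB, lc], div_mul_cancel₀ _ hb, lc, sub_self]
    · rw [coeff_eq_zero_of_ord_lt hk, coeff_eq_zero_of_ord_lt (hAB ▸ hk), mul_zero, sub_self]
  exact not_le.mp fun h => lc_ne_zero hne (hcoeff _ h)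

/-- A space of operators commuting with `L` that contains operators of all possible orders is the
whole centralizer. -/
theorem centralizer_le_of_forall_ord [CharZero K] {L : DiffOp K} (hL : L.ord = 3)
    (N : Submodule (constants K) (DiffOp K))
    (hN : ∀ A ∈ L.centralizer, A ≠ 0 → ∃ B ∈ L.centralizer, B ∈ N ∧ B ≠ 0 ∧ B.ord = A.ord)
    {A : DiffOp K} (hA : A ∈ L.centralizer) : A ∈ N := by
  induction h : A.ord using Nat.strong_induction_on generalizing A with
  | _ n ih =>
    rcases eq_or_ne A 0 with rfl | hA0
    · exact N.zero_mem
    obtain ⟨B, hB, hBN, hB0, hBA⟩ := hN A hA hA0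
    -- Subtracting the multiple of `B` lowers the order while staying in the centralizer.
    obtain ⟨c, hc⟩ := exists_const_ord_sub_lt hL hA hB hB0 hBA.symm
    rw [← sub_add_cancel A (c • B)]
    refine N.add_mem ?_ (N.smul_mem c hBN)
    rcases hc with hc | hc
    · rw [hc]; exact N.zero_mem
    · exact ih _ (h ▸ hc) (sub_mem hA (Subalgebra.smul_mem _ hB c)) rfl

/-- The powers of `L` have distinct orders 3i, so the order of a polynomial in `L` is one of these.
-/
theorem three_dvd_ord_of_mem_constPoly {L P : DiffOp K} (hL : L.ord = 3) (hP : P ∈ L.constPoly)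
    (hP0 : P ≠ 0) : 3 ∣ P.ord := by
  obtain ⟨q, rfl⟩ := mem_constPoly.mp hP
  have hL0 := ne_zero_of_ord_eq_three hL
  have hord : ∀ i ∈ q.support, (q.coeff i • L ^ i) ≠ 0 ∧ (q.coeff i • L ^ i).ord = i * 3 := by
    intro i hi
    have hc : ((q.coeff i : constants K) : K) ≠ 0 := by simpa using hi
    exact ⟨smul_ne_zero (by simpa using hi) (pow_ne_zero _ hL0),
      (ord_smul hc _).trans (by rw [ord_pow hL0, hL])⟩
  rw [Polynomial.aeval_eq_sum_range, ← Polynomial.sum_over_range' q (f := fun i a => a • L ^ i)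
    (by simp) _ (Nat.lt_succ_self _), Polynomial.sum_def] at hP0 ⊢
  obtain ⟨i, hi, -, h⟩ := exists_ord_sum_eq (s := q.support) (P := fun i => q.coeff i • L ^ i)
    (Finset.nonempty_iff_ne_empty.mpr fun h => hP0 (by rw [h, Finset.sum_empty]))
    (fun i hi => (hord i hi).1) (fun i hi j hj h => by
      have := ((hord i hi).2.symm.trans h).trans (hord j hj).2
      omega)
  rw [h, (hord i hi).2]
  exact Dvd.intro_left i rfl

/-- A nonzero factor from C[L] shifts orders by a multiple of 3, so terms in different residue
classes cannot cancel. -/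
theorem linearIndependent_constPoly {L : DiffOp K} (hL : L.ord = 3) {ι : Type*} {P : ι → DiffOp K}
    (h0 : ∀ i, P i ≠ 0) (hP : Function.Injective fun i => (P i).ord % 3) :
    LinearIndependent L.constPoly P := by
  rw [linearIndependent_iff']
  intro s g hg i hi
  have h := eq_zero_of_sum_eq_zero (s := s) (P := fun i => g i • P i) (fun i _ j _ hi0 hj0 hij => ?_)
    hg i hi
  · rw [Subalgebra.smul_def, smul_eq_mul] at h
    exact Subtype.ext ((mul_eq_zero.mp h).resolve_right (h0 i))
  · simp only [Subalgebra.smul_def, smul_eq_mul] at hi0 hj0 hij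
    rw [ord_mul (left_ne_zero_of_mul hi0) (h0 i), ord_mul (left_ne_zero_of_mul hj0) (h0 j)] at hij
    have h1 := three_dvd_ord_of_mem_constPoly hL (g i).2 (left_ne_zero_of_mul hi0)
    have h2 := three_dvd_ord_of_mem_constPoly hL (g j).2 (left_ne_zero_of_mul hj0)
    exact hP (show (P i).ord % 3 = (P j).ord % 3 by omega)

/-- Otherwise the powers of `L` would attain every order in the centralizer, which would then be
C[L]. -/
theorem exists_ord_mod_three_ne_zero [CharZero K] {L : DiffOp K} (hL : L.ord = 3)
    (hZ : L.centralizer ≠ L.constPoly) : ∃ A ∈ L.centralizer, A ≠ 0 ∧ A.ord % 3 ≠ 0 := by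
  by_contra! h
  refine hZ (le_antisymm (fun A hA => ?_) (constPoly_le_centralizer L))
  refine centralizer_le_of_forall_ord hL (Subalgebra.toSubmodule L.constPoly)
    (fun A hA hA0 => ?_) hA
  have hL0 := ne_zero_of_ord_eq_three hL
  refine ⟨L ^ (A.ord / 3), pow_mem (self_mem_centralizer L) _,
    pow_mem (self_mem_constPoly L) _, pow_ne_zero _ hL0, ?_⟩
  rw [ord_pow hL0, hL]
  have := h A hA hA0
  omega

theorem exists_ord_mod_three_eq [CharZero K] {L : DiffOp K} (hL : L.ord = 3)
    (hZ : L.centralizer ≠ L.constPoly) {r : ℕ} (hr : r < 3) :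
    ∃ A ∈ L.centralizer, A ≠ 0 ∧ A.ord % 3 = r := by
  obtain ⟨A, hA, hA0, hAr⟩ := exists_ord_mod_three_ne_zero hL hZ
  have key : ∀ n : ℕ, A ^ n ∈ L.centralizer ∧ A ^ n ≠ 0 ∧ (A ^ n).ord % 3 = n * A.ord % 3 :=
    fun n => ⟨pow_mem hA n, pow_ne_zero n hA0, by rw [ord_pow hA0]⟩
  -- A residue prime to 3 is its own inverse mod 3, so the power `r * A.ord` of `A` has order
  -- congruent to `r`.
  have h : r * A.ord * A.ord % 3 = r := by
    rw [mul_assoc, Nat.mul_mod, Nat.mul_mod A.ord]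
    have : A.ord % 3 < 3 := Nat.mod_lt _ (by norm_num)
    interval_cases A.ord % 3 <;> interval_cases r <;> simp_all
  obtain ⟨h1, h2, h3⟩ := key (r * A.ord)
  exact ⟨_, h1, h2, h3.trans h⟩

theorem exists_minimal_ord_mod_three_eq [CharZero K] {L : DiffOp K} (hL : L.ord = 3)
    (hZ : L.centralizer ≠ L.constPoly) {r : ℕ} (hr : r < 3) :
    ∃ A ∈ L.centralizer, A ≠ 0 ∧ A.ord % 3 = r ∧
      ∀ B ∈ L.centralizer, B ≠ 0 → B.ord % 3 = r → A.ord ≤ B.ord := by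
  classical
  have h : ∃ n, ∃ A ∈ L.centralizer, A ≠ 0 ∧ A.ord % 3 = r ∧ A.ord = n := by
    obtain ⟨A, h1, h2, h3⟩ := exists_ord_mod_three_eq hL hZ hr
    exact ⟨_, A, h1, h2, h3, rfl⟩
  obtain ⟨A, h1, h2, h3, h4⟩ := Nat.find_spec h
  exact ⟨A, h1, h2, h3, fun B hB hB0 hBr => h4 ▸ Nat.find_min' h ⟨B, hB, hB0, hBr, rfl⟩⟩

/-- The basis elements have minimal order in their residue classes, so multiplying them by powers of
`L` reaches every order in the centralizer. The information on `A₁` is kept for the proof of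
commutativity. -/
theorem exists_isCentralizerBasis [CharZero K] {L : DiffOp K} (hL : L.ord = 3)
    (hZ : L.centralizer ≠ L.constPoly) :
    ∃ A₁ A₂ : DiffOp K, L.IsCentralizerBasis A₁ A₂ ∧ A₁ ≠ 0 ∧ A₁.ord % 3 = 1 := by
  obtain ⟨A₁, h1, h10, h1r, h1m⟩ := exists_minimal_ord_mod_three_eq hL hZ (r := 1) (by norm_num)
  obtain ⟨A₂, h2, h20, h2r, h2m⟩ := exists_minimal_ord_mod_three_eq hL hZ (r := 2) (by norm_num)
  have hL0 := ne_zero_of_ord_eq_three hL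
  refine ⟨A₁, A₂, ⟨?_, ?_⟩, h10, h1r⟩
  · refine linearIndependent_constPoly hL (Fin.forall_fin_succ.mpr ⟨one_ne_zero, ?_⟩) ?_
    · intro i
      fin_cases i
      exacts [h10, h20]
    · intro i j hij
      have := ord_one (K := K)
      fin_cases i <;> fin_cases j <;> simp_all
  · have hmem : ∀ i, ![1, A₁, A₂] i ∈ L.centralizer := by
      intro i
      fin_cases i
      exacts [one_mem _, h1, h2]
    refine Set.Subset.antisymm (fun A hA => ?_) fun A hA => ?_
    · refine Submodule.span_induction (p := fun A _ => A ∈ L.centralizer) ?_ (zero_mem _)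
        (fun _ _ _ _ => add_mem) (fun p A _ hA => ?_) hA
      · rintro _ ⟨i, rfl⟩
        exact hmem i
      · rw [Subalgebra.smul_def, smul_eq_mul]
        exact mul_mem (constPoly_le_centralizer L p.2) hA
    · refine centralizer_le_of_forall_ord hL
        ((Submodule.span L.constPoly (Set.range ![1, A₁, A₂])).restrictScalars (constants K))
        (fun A hA hA0 => ?_) hA
      obtain ⟨i, hi0, hir, hio⟩ : ∃ i, ![1, A₁, A₂] i ≠ 0 ∧
          (![1, A₁, A₂] i).ord % 3 = A.ord % 3 ∧ (![1, A₁, A₂] i).ord ≤ A.ord := by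
        have : A.ord % 3 < 3 := Nat.mod_lt _ (by norm_num)
        interval_cases hr : A.ord % 3
        · exact ⟨0, one_ne_zero, by simp [ord_one], by simp [ord_one]⟩
        · exact ⟨1, h10, h1r, h1m A hA hA0 hr⟩
        · exact ⟨2, h20, h2r, h2m A hA hA0 hr⟩
      -- Subtraction and division are exact here: the orders are congruent mod 3 and the basis
      -- element has the smaller one.
      have hLk : L ^ ((A.ord - (![1, A₁, A₂] i).ord) / 3) ∈ L.constPoly :=
        pow_mem (self_mem_constPoly L) _
      refine ⟨L ^ ((A.ord - (![1, A₁, A₂] i).ord) / 3) * ![1, A₁, A₂] i,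
        mul_mem (constPoly_le_centralizer L hLk) (hmem i), ?_, mul_ne_zero (pow_ne_zero _ hL0) hi0,
        ?_⟩
      · have := Submodule.smul_mem (Submodule.span L.constPoly (Set.range ![1, A₁, A₂]))
          (⟨_, hLk⟩ : L.constPoly) (Submodule.subset_span (Set.mem_range_self i))
        rwa [Subalgebra.smul_def, smul_eq_mul] at this
      · rw [ord_mul (pow_ne_zero _ hL0) hi0, ord_pow hL0, hL]
        omega

open scoped IsMulCommutative in
/-- If `A` commutes with `L` and has order congruent to `1` modulo `3`, then every operator
commuting with `L` is, up to a factor from `C[L]`, a polynomial in `A` over `C[L]`. -/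
theorem exists_mul_eq_of_mem_centralizer {L A₁ A₂ A B : DiffOp K} (hL : L.ord = 3)
    (h : L.IsCentralizerBasis A₁ A₂) (hA : A ∈ L.centralizer) (hA0 : A ≠ 0) (hAr : A.ord % 3 = 1)
    (hB : B ∈ L.centralizer) :
    ∃ q ∈ L.constPoly, ∃ p₀ ∈ L.constPoly, ∃ p₁ ∈ L.constPoly, ∃ p₂ ∈ L.constPoly,
      q ≠ 0 ∧ q * B = p₀ + p₁ * A + p₂ * A ^ 2 := by
  have : IsMulCommutative L.constPoly :=
    inferInstanceAs (IsMulCommutative (Algebra.adjoin (constants K) {L}))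
  have : StrongRankCondition L.constPoly := commRing_strongRankCondition L.constPoly
  have : Fintype (Set.range ![1, A₁, A₂]) := Fintype.ofFinite _
  -- Four elements of a module spanned by three over a commutative ring.
  have hdep : ¬ LinearIndependent L.constPoly ![1, A, A ^ 2, B] := by
    intro hli
    have hle := linearIndependent_le_span_aux' (R := L.constPoly) ![1, A, A ^ 2, B] hli
      (Set.range ![1, A₁, A₂]) (by
        rw [h.span_eq]
        rintro _ ⟨i, rfl⟩
        fin_cases i
        exacts [one_mem L.centralizer, hA, pow_mem hA 2, hB])
    have := Fintype.card_range_le (![1, A₁, A₂] : Fin 3 → DiffOp K)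
    rw [Fintype.card_fin] at hle this
    omega
  rw [Fintype.not_linearIndependent_iff] at hdep
  obtain ⟨g, hg, i, hi⟩ := hdep
  simp only [Fin.sum_univ_four, Subalgebra.smul_def, smul_eq_mul] at hg
  -- The orders have residues 0, 1, 2, so the dependence must involve `B`, and its coefficient
  -- provides `q`.
  have hli : LinearIndependent L.constPoly ![1, A, A ^ 2] := by
    refine linearIndependent_constPoly hL (fun i => ?_) fun i j hij => ?_
    · fin_cases i
      exacts [one_ne_zero, hA0, pow_ne_zero 2 hA0]
    · have h1 := ord_one (K := K)
      have h2 := ord_pow hA0 2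
      have h3 : (A ^ 2).ord % 3 = 2 := by omega
      fin_cases i <;> fin_cases j <;> simp_all
  refine ⟨-g 3, neg_mem (g 3).2, g 0, (g 0).2, g 1, (g 1).2, g 2, (g 2).2, fun h3 => hi ?_, ?_⟩
  · have h3' : ((g 3 : L.constPoly) : DiffOp K) = 0 := neg_eq_zero.mp h3
    rw [Fintype.linearIndependent_iff] at hli
    have := hli ![g 0, g 1, g 2] (by
      simp only [Fin.sum_univ_three, Subalgebra.smul_def, smul_eq_mul]
      rw [h3', zero_mul, add_zero] at hg
      exact hg)
    fin_cases i
    exacts [this 0, this 1, this 2, Subtype.ext h3']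
  · have hg' : (g 0 : DiffOp K) * 1 + g 1 * A + g 2 * A ^ 2 + g 3 * B = 0 := hg
    rw [mul_one] at hg'
    rw [neg_mul, ← sub_eq_zero, ← neg_eq_zero, ← hg']
    abel

theorem commute_of_mem_constPoly {L A q : DiffOp K} (hA : A ∈ L.centralizer)
    (hq : q ∈ L.constPoly) : Commute q A := by
  have : L.constPoly ≤ Subalgebra.centralizer (constants K) {A} :=
    Algebra.adjoin_le (by
      rw [Set.singleton_subset_iff, SetLike.mem_coe, Subalgebra.mem_centralizer_iff]
      rintro _ rfl
      exact (mem_centralizer.mp hA).symm)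
  exact ((Subalgebra.mem_centralizer_iff _).mp (this hq) A rfl).symm

theorem commute_of_commute_mul {A B q : DiffOp K} (hq : q ≠ 0) (hqA : Commute q A)
    (h : Commute (q * B) A) : Commute B A := by
  refine mul_left_cancel₀ hq ?_
  rw [← mul_assoc, h.eq, ← mul_assoc, ← mul_assoc, hqA.eq]

/-- Up to a nonzero factor from C[L], every element is a polynomial in `A₁` over C[L]. Hence
whatever lies in the centralizer and commutes with `A₁` commutes with everything there. -/
theorem commute_of_mem_centralizer [CharZero K] {L A B : DiffOp K} (hL : L.ord = 3)
    (hZ : L.centralizer ≠ L.constPoly) (hA : A ∈ L.centralizer) (hB : B ∈ L.centralizer) :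
    Commute A B := by
  obtain ⟨A₁, A₂, hbasis, h0, hr⟩ := exists_isCentralizerBasis hL hZ
  have h1 : A₁ ∈ L.centralizer := by
    rw [← SetLike.mem_coe, ← hbasis.span_eq]
    exact Submodule.subset_span ⟨1, rfl⟩
  have step : ∀ B ∈ L.centralizer, Commute A₁ B →
      ∀ A ∈ L.centralizer, Commute A B := by
    intro B hB h A hA
    obtain ⟨q, hq, p₀, hp₀, p₁, hp₁, p₂, hp₂, hq0, heq⟩ :=
      exists_mul_eq_of_mem_centralizer hL hbasis h1 h0 hr hA
    refine commute_of_commute_mul hq0 (commute_of_mem_constPoly hB hq) ?_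
    rw [heq]
    exact ((commute_of_mem_constPoly hB hp₀).add_left
      ((commute_of_mem_constPoly hB hp₁).mul_left h)).add_left
      ((commute_of_mem_constPoly hB hp₂).mul_left (h.pow_left 2))
  -- The inner use of `step` shows that `B` commutes with `A₁`, the outer one that it commutes with
  -- `A`.
  exact step B hB (step A₁ h1 (Commute.refl _) B hB).symm A hA

end DiffOp

/-! ### Derivations on quotients and fraction fields; differential ideals. -/

/-- A derivation descends uniquely to the quotient by an ideal that it preserves. -/
theorem Derivation.existsUnique_quotient {A : Type*} [CommRing A] (d : Derivation ℤ A A)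
    (I : Ideal A) (hI : ∀ f ∈ I, d f ∈ I) :
    ∃! δ : Derivation ℤ (A ⧸ I) (A ⧸ I),
      ∀ q, δ (Ideal.Quotient.mk I q) = Ideal.Quotient.mk I (d q) := by
  have hd : ∀ x, (Ideal.Quotient.mkₐ ℤ I) x = 0 → (Ideal.Quotient.mkₐ ℤ I) (d x) = 0 := by
    intro x hx
    exact Ideal.Quotient.eq_zero_iff_mem.mpr (hI x (Ideal.Quotient.eq_zero_iff_mem.mp hx))
  refine ⟨Derivation.liftOfSurjective (Ideal.Quotient.mkₐ_surjective ℤ I) hd,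
    fun q => Derivation.liftOfSurjective_apply _ hd q, fun δ hδ => ?_⟩
  ext x
  obtain ⟨q, rfl⟩ := Ideal.Quotient.mk_surjective x
  rw [hδ]
  exact (Derivation.liftOfSurjective_apply _ hd q).symm

/-- A derivation of a domain extends uniquely to its field of fractions. -/
theorem Derivation.existsUnique_isFractionRing {R A F : Type*} [CommRing R] [CommRing A]
    [Field F] [Algebra R A] [Algebra R F] [Algebra A F] [IsScalarTower R A F] [IsFractionRing A F]
    (d : Derivation R A A) :
    ∃! δ : Derivation R F F, ∀ a, δ (algebraMap A F a) = algebraMap A F (d a) := by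
  have hunit : ∀ x : nonZeroDivisors A, IsUnit (algebraMap A (Module.End A F) x) :=
    IsLocalizedModule.map_units (Algebra.linearMap A F)
  -- Kähler differentials localize, so the linear map on Ω[A⁄R] classifying `d` extends to Ω[F⁄R].
  -- Uniqueness below is the quotient rule.
  let φ : Ω[F⁄R] →ₗ[A] F :=
    IsLocalizedModule.lift (nonZeroDivisors A) (KaehlerDifferential.map R R A F)
      (Algebra.linearMap A F ∘ₗ d.liftKaehlerDifferential) hunit
  let ψ := LinearMap.extendScalarsOfIsLocalization (nonZeroDivisors A) F φ
  refine ⟨ψ.compDer (KaehlerDifferential.D R F), fun a => ?_, fun δ hδ => ?_⟩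
  · change φ (KaehlerDifferential.D R F (algebraMap A F a)) = _
    rw [← KaehlerDifferential.map_D R R A F a, IsLocalizedModule.lift_apply]
    simp
  · have h : ∀ a, ψ.compDer (KaehlerDifferential.D R F) (algebraMap A F a) =
        algebraMap A F (d a) := fun a => by
      change φ (KaehlerDifferential.D R F (algebraMap A F a)) = _
      rw [← KaehlerDifferential.map_D R R A F a, IsLocalizedModule.lift_apply]
      simp
    ext x
    obtain ⟨a, b, -, rfl⟩ := IsFractionRing.div_surjective (A := A) x
    rw [Derivation.leibniz_div, Derivation.leibniz_div, hδ, hδ, h, h]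

set_option linter.overlappingInstances false in
/-- The derivations over `ℤ` of a domain extend uniquely to its field of fractions, whatever the
`ℤ`-module structure used to state that they are linear. -/
theorem Derivation.existsUnique_isFractionRing_int {A F : Type*} [CommRing A] [Field F]
    [Algebra ℤ F] [m : Module ℤ F] [Algebra A F] [IsFractionRing A F] (d : Derivation ℤ A A) :
    ∃! δ : Derivation ℤ F F, ∀ a, δ (algebraMap A F a) = algebraMap A F (d a) := by
  have : @IsScalarTower ℤ A F Algebra.toSMul Algebra.toSMul Algebra.toSMul :=
    .of_algebraMap_eq' (Subsingleton.elim _ _)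
  obtain rfl : m = Algebra.toModule := Subsingleton.elim _ _
  exact Derivation.existsUnique_isFractionRing d

/-- A differential ideal is generated by a set as a differential ideal if it is so as an ideal. -/
theorem differentialSpan_eq_span {K : Type*} [Field K] [Differential K]
    {S : Set (MvPolynomial (Fin 3) K)} (h : IsDifferentialIdeal (Ideal.span S)) :
    differentialSpan S = Ideal.span S :=
  le_antisymm (sInf_le ⟨Ideal.subset_span, h⟩)
    (le_sInf fun _ hI => Ideal.span_le.mpr hI.1)

theorem isDifferentialIdeal_span {K : Type*} [Field K] [Differential K]
    {S : Set (MvPolynomial (Fin 3) K)} (h : ∀ f ∈ S, polyDeriv K f = 0) :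
    IsDifferentialIdeal (Ideal.span S) := by
  intro f hf
  induction hf using Submodule.span_induction with
  | mem f hf => rw [h f hf]; exact zero_mem _
  | zero => rw [map_zero]; exact zero_mem _
  | add f g _ _ hf hg => rw [map_add]; exact add_mem hf hg
  | smul a f hfS hf =>
    rw [smul_eq_mul, Derivation.leibniz]
    refine add_mem (Ideal.mul_mem_left _ _ hf) ?_
    rw [smul_eq_mul, mul_comm]
    exact Ideal.mul_mem_left _ _ hfS

theorem polyDeriv_map_constants {K : Type*} [Field K] [Differential K]
    (g : MvPolynomial (Fin 3) (constants K)) :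
    polyDeriv K (MvPolynomial.map (constants K).subtype g) = 0 := by
  ext m
  rw [coeff_polyDeriv, MvPolynomial.coeff_map, MvPolynomial.coeff_zero]
  exact (g.coeff m).2

/-! ### The evaluation maps and the Burchnall–Chaundy ideal. -/

namespace DiffOp

variable {K : Type*} [Field K] [Differential K]

theorem eval_monomial (L A₁ A₂ : DiffOp K) (α : Fin 3 →₀ ℕ) (c : constants K) :
    L.eval A₁ A₂ (MvPolynomial.monomial α c) = c • (L ^ α 0 * A₁ ^ α 1 * A₂ ^ α 2) := by
  have h := (MvPolynomial.basisMonomials (Fin 3) (constants K)).constr_basis (constants K)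
    (fun α => L ^ α 0 * A₁ ^ α 1 * A₂ ^ α 2) α
  rw [MvPolynomial.coe_basisMonomials] at h
  rw [← mul_one c, ← smul_eq_mul, ← MvPolynomial.smul_monomial, map_smul, eval, h, smul_eq_mul,
    mul_one]

theorem evalK_monomial (L A₁ A₂ : DiffOp K) (α : Fin 3 →₀ ℕ) (c : K) :
    L.evalK A₁ A₂ (MvPolynomial.monomial α c) = c • (L ^ α 0 * A₁ ^ α 1 * A₂ ^ α 2) := by
  have h := (MvPolynomial.basisMonomials (Fin 3) K).constr_basis K
    (fun α => L ^ α 0 * A₁ ^ α 1 * A₂ ^ α 2) α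
  rw [MvPolynomial.coe_basisMonomials] at h
  rw [← mul_one c, ← smul_eq_mul, ← MvPolynomial.smul_monomial, map_smul, evalK, h, smul_eq_mul,
    mul_one]

theorem evalK_map (L A₁ A₂ : DiffOp K) (g : MvPolynomial (Fin 3) (constants K)) :
    L.evalK A₁ A₂ (MvPolynomial.map (constants K).subtype g) = L.eval A₁ A₂ g := by
  induction g using MvPolynomial.induction_on' with
  | monomial α c => rw [MvPolynomial.map_monomial, evalK_monomial, eval_monomial]; rfl
  | add p q hp hq => rw [map_add, map_add, hp, hq, map_add]

theorem eval_one (L A₁ A₂ : DiffOp K) : L.eval A₁ A₂ 1 = 1 := by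
  rw [← MvPolynomial.C_1, ← MvPolynomial.monomial_zero', eval_monomial]
  simp

theorem eval_mul {L A₁ A₂ : DiffOp K} (h₁ : Commute L A₁) (h₂ : Commute L A₂)
    (h₁₂ : Commute A₁ A₂) (f g : MvPolynomial (Fin 3) (constants K)) :
    L.eval A₁ A₂ (f * g) = L.eval A₁ A₂ f * L.eval A₁ A₂ g := by
  induction f using MvPolynomial.induction_on' with
  | add p q hp hq => rw [add_mul, map_add, hp, hq, map_add, add_mul]
  | monomial α c =>
    induction g using MvPolynomial.induction_on' with
    | add p q hp hq => rw [mul_add, map_add, hp, hq, map_add, mul_add]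
    | monomial β d =>
      rw [MvPolynomial.monomial_mul, eval_monomial, eval_monomial, eval_monomial,
        smul_mul_smul_comm]
      congr 1
      simp only [Finsupp.add_apply, pow_add]
      have e₁ := (h₁.pow_pow (β 0) (α 1)).eq
      have e₂ := (h₂.pow_pow (β 0) (α 2)).eq
      have e₃ := (h₁₂.pow_pow (β 1) (α 2)).eq
      simp only [mul_assoc]
      congr 1
      rw [← mul_assoc (A₂ ^ α 2) (L ^ β 0), ← e₂, mul_assoc (L ^ β 0),
        ← mul_assoc (A₂ ^ α 2) (A₁ ^ β 1), ← e₃, mul_assoc (A₁ ^ β 1),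
        ← mul_assoc (A₁ ^ α 1) (L ^ β 0), ← e₁, mul_assoc (L ^ β 0)]

/-- `e_L` as a homomorphism of algebras. -/
noncomputable def evalHom {L A₁ A₂ : DiffOp K} (h₁ : Commute L A₁) (h₂ : Commute L A₂)
    (h₁₂ : Commute A₁ A₂) : MvPolynomial (Fin 3) (constants K) →ₐ[constants K] DiffOp K :=
  AlgHom.ofLinearMap (L.eval A₁ A₂) (eval_one L A₁ A₂) (eval_mul h₁ h₂ h₁₂)

theorem IsCentralizerBasis.mem_centralizer_left {L A₁ A₂ : DiffOp K}
    (h : L.IsCentralizerBasis A₁ A₂) : A₁ ∈ L.centralizer := by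
  rw [← SetLike.mem_coe, ← h.span_eq]
  exact Submodule.subset_span ⟨1, rfl⟩

theorem IsCentralizerBasis.mem_centralizer_right {L A₁ A₂ : DiffOp K}
    (h : L.IsCentralizerBasis A₁ A₂) : A₂ ∈ L.centralizer := by
  rw [← SetLike.mem_coe, ← h.span_eq]
  exact Submodule.subset_span ⟨2, rfl⟩

/-- This lets the order arguments for the centralizer be applied to values of `e_L`. -/
theorem range_evalHom {L A₁ A₂ : DiffOp K} (h : L.IsCentralizerBasis A₁ A₂) (h₁ : Commute L A₁)
    (h₂ : Commute L A₂) (h₁₂ : Commute A₁ A₂) : (evalHom h₁ h₂ h₁₂).range = L.centralizer := by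
  have hX : ∀ i, evalHom h₁ h₂ h₁₂ (MvPolynomial.X i) = ![L, A₁, A₂] i := by
    intro i
    refine (eval_monomial L A₁ A₂ (Finsupp.single i 1) 1).trans ?_
    fin_cases i <;> simp
  refine le_antisymm ?_ fun A hA => ?_
  · rintro _ ⟨f, rfl⟩
    change L.eval A₁ A₂ f ∈ _
    induction f using MvPolynomial.induction_on' with
    | add p q hp hq => rw [map_add]; exact add_mem hp hq
    | monomial α c =>
      rw [eval_monomial]
      exact Subalgebra.smul_mem _ (mul_mem (mul_mem (pow_mem (self_mem_centralizer L) _)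
        (pow_mem h.mem_centralizer_left _)) (pow_mem h.mem_centralizer_right _)) c
  · rw [← SetLike.mem_coe, ← h.span_eq] at hA
    have hC : L.constPoly ≤ (evalHom h₁ h₂ h₁₂).range :=
      Algebra.adjoin_le (Set.singleton_subset_iff.mpr ⟨_, hX 0⟩)
    refine Submodule.span_induction (p := fun A _ => A ∈ (evalHom h₁ h₂ h₁₂).range) ?_
      (zero_mem _) (fun _ _ _ _ => add_mem) (fun p A _ hA => ?_) hA
    · rintro _ ⟨i, rfl⟩
      fin_cases i
      exacts [one_mem _, ⟨_, hX 1⟩, ⟨_, hX 2⟩]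
    · rw [Subalgebra.smul_def, smul_eq_mul]
      exact mul_mem (hC p.2) hA

/-- Although `ε_L` is not multiplicative, the coefficient of a monomial can be pulled out on the
left; what remains has constant coefficients, where `e_L` is multiplicative. -/
theorem evalK_eq_zero_of_mem_span {L A₁ A₂ : DiffOp K} (h₁ : Commute L A₁) (h₂ : Commute L A₂)
    (h₁₂ : Commute A₁ A₂) {f : MvPolynomial (Fin 3) K} (hf : f ∈ Ideal.span (L.BCExt A₁ A₂)) :
    L.evalK A₁ A₂ f = 0 := by
  have key : ∀ p g : MvPolynomial (Fin 3) K, g ∈ L.BCExt A₁ A₂ → L.evalK A₁ A₂ (p * g) = 0 := by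
    rintro p _ ⟨g, hg, rfl⟩
    induction p using MvPolynomial.induction_on' with
    | add p q hp hq => rw [add_mul, map_add, hp, hq, add_zero]
    | monomial α c =>
      rw [show MvPolynomial.monomial α c =
        c • MvPolynomial.map (constants K).subtype (MvPolynomial.monomial α 1) by
          rw [MvPolynomial.map_monomial, map_one, MvPolynomial.smul_monomial, smul_eq_mul, mul_one],
        smul_mul_assoc, map_smul, ← map_mul, evalK_map, eval_mul h₁ h₂ h₁₂,
        show L.eval A₁ A₂ g = 0 from hg, mul_zero, smul_zero]
  induction hf using Submodule.span_induction with
  | mem f hf => rw [← one_mul f]; exact key 1 f hf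
  | zero => exact map_zero _
  | add f g _ _ hf hg => rw [map_add, hf, hg, add_zero]
  | smul p f hf _ =>
    -- The vanishing of `ε_L` at `f` says nothing about `p • f`, so a second induction runs with `p`
    -- arbitrary.
    clear * - hf key
    induction hf using Submodule.span_induction generalizing p with
    | mem f hf => exact key p f hf
    | zero => rw [smul_zero, map_zero]
    | add f g _ _ hf hg => rw [smul_add, map_add, hf, hg, add_zero]
    | smul q f _ hf => rw [smul_smul]; exact hf _

/-- Modulo the Burchnall–Chaundy ideal, polynomials are `K`-linear combinations of polynomials with
constant coefficients whose values at `(L, A₁, A₂)` have distinct orders. -/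
theorem exists_span_eval_ord [CharZero K] {L A₁ A₂ : DiffOp K} (hL : L.ord = 3)
    (h : L.IsCentralizerBasis A₁ A₂) (h₁ : Commute L A₁) (h₂ : Commute L A₂)
    (h₁₂ : Commute A₁ A₂) :
    ∃ (S : Set ℕ) (p : S → MvPolynomial (Fin 3) (constants K)),
      (∀ s, L.eval A₁ A₂ (p s) ≠ 0) ∧ (∀ s, (L.eval A₁ A₂ (p s)).ord = s) ∧
      ∀ f : MvPolynomial (Fin 3) K, ∃ a : S →₀ K,
        f - ∑ s ∈ a.support, a s • MvPolynomial.map (constants K).subtype (p s) ∈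
          Ideal.span (L.BCExt A₁ A₂) := by
  let S : Set ℕ := {s | ∃ g, L.eval A₁ A₂ g ≠ 0 ∧ (L.eval A₁ A₂ g).ord = s}
  have hS : ∀ s : S, ∃ g, L.eval A₁ A₂ g ≠ 0 ∧ (L.eval A₁ A₂ g).ord = s := fun s => s.2
  choose p hp0 hp using hS
  refine ⟨S, p, hp0, hp, fun f => ?_⟩
  have hrange := range_evalHom h h₁ h₂ h₁₂
  have hmem : ∀ g, L.eval A₁ A₂ g ∈ L.centralizer := fun g => hrange ▸ ⟨g, rfl⟩
  have hspan : ∀ g, L.eval A₁ A₂ g ∈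
      Submodule.span (constants K) (Set.range fun s => L.eval A₁ A₂ (p s)) := by
    -- One operator for each attained order suffices to span the centralizer over the constants.
    refine fun g => centralizer_le_of_forall_ord hL _ (fun A hA hA0 => ?_) (hmem g)
    rw [← hrange] at hA
    obtain ⟨g, rfl⟩ := hA
    exact ⟨_, hmem _, Submodule.subset_span ⟨⟨_, g, hA0, rfl⟩, rfl⟩, hp0 _, hp _⟩
  let N : Submodule K (MvPolynomial (Fin 3) K) :=
    Submodule.span K (Set.range fun s => MvPolynomial.map (constants K).subtype (p s)) ⊔
      (Ideal.span (L.BCExt A₁ A₂)).restrictScalars K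
  have hN : ∀ g, MvPolynomial.map (constants K).subtype g ∈ N := by
    intro g
    obtain ⟨c, hc⟩ := (Finsupp.mem_span_range_iff_exists_finsupp).mp (hspan g)
    have hBC : g - c.sum (fun s x => x • p s) ∈ L.BC A₁ A₂ := by
      change L.eval A₁ A₂ _ = 0
      rw [map_sub, ← hc, Finsupp.sum, Finsupp.sum, map_sum, sub_eq_zero]
      simp only [map_smul]
    rw [← sub_add_cancel g (c.sum fun s x => x • p s), map_add]
    refine N.add_mem (Submodule.mem_sup_right (Ideal.subset_span ⟨_, hBC, rfl⟩)) ?_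
    rw [Finsupp.sum, map_sum]
    refine N.sum_mem fun s _ => Submodule.mem_sup_left ?_
    rw [MvPolynomial.smul_eq_C_mul, map_mul, MvPolynomial.map_C, ← MvPolynomial.smul_eq_C_mul]
    exact Submodule.smul_mem _ _ (Submodule.subset_span ⟨s, rfl⟩)
  have hf : f ∈ N := by
    induction f using MvPolynomial.induction_on' with
    | add f g hf hg => exact N.add_mem hf hg
    | monomial α c =>
      have := N.smul_mem c (hN (MvPolynomial.monomial α 1))
      rwa [MvPolynomial.map_monomial, map_one, MvPolynomial.smul_monomial, smul_eq_mul,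
        mul_one] at this
  obtain ⟨x, hx, y, hy, rfl⟩ := Submodule.mem_sup.mp hf
  obtain ⟨a, rfl⟩ := (Finsupp.mem_span_range_iff_exists_finsupp).mp hx
  exact ⟨a, by rw [Finsupp.sum, add_sub_cancel_left]; exact hy⟩

/-- Reduced modulo (BC(L)), `f` becomes a combination of polynomials whose values have distinct
orders. If its value is zero, all its coefficients vanish. -/
theorem mem_span_BCExt_iff [CharZero K] {L A₁ A₂ : DiffOp K} (hL : L.ord = 3)
    (h : L.IsCentralizerBasis A₁ A₂) (h₁ : Commute L A₁) (h₂ : Commute L A₂)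
    (h₁₂ : Commute A₁ A₂) (f : MvPolynomial (Fin 3) K) :
    L.evalK A₁ A₂ f = 0 ↔ f ∈ Ideal.span (L.BCExt A₁ A₂) := by
  refine ⟨fun hf => ?_, evalK_eq_zero_of_mem_span h₁ h₂ h₁₂⟩
  obtain ⟨S, p, hp0, hp, hS⟩ := exists_span_eval_ord hL h h₁ h₂ h₁₂
  obtain ⟨a, ha⟩ := hS f
  have h0 := evalK_eq_zero_of_mem_span h₁ h₂ h₁₂ ha
  simp only [map_sub, hf, zero_sub, neg_eq_zero, map_sum, map_smul, evalK_map] at h0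
  have := eq_zero_of_sum_eq_zero (fun i hi j hj _ _ hij => by
    rw [ord_smul (Finsupp.mem_support_iff.mp hi), ord_smul (Finsupp.mem_support_iff.mp hj), hp,
      hp] at hij
    exact Subtype.ext hij) h0
  rwa [Finset.sum_eq_zero, sub_zero] at ha
  intro s hs
  rw [(smul_eq_zero.mp (this s hs)).resolve_right (hp0 s), zero_smul]

/-- Only the pair of maximal orders contributes to the top coefficient. With both scalars on the
left, this sum is the value of `ε_L` at a product of polynomials, not a product of two values. -/
theorem sum_sum_smul_mul_ne_zero {ι : Type*} {P : ι → DiffOp K} (h0 : ∀ i, P i ≠ 0)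
    (hP : Function.Injective fun i => (P i).ord) {s t : Finset ι} (hs : s.Nonempty)
    (ht : t.Nonempty) {a b : ι → K} (ha : ∀ i ∈ s, a i ≠ 0) (hb : ∀ j ∈ t, b j ≠ 0) :
    ∑ i ∈ s, ∑ j ∈ t, (a i * b j) • (P i * P j) ≠ 0 := by
  obtain ⟨i, hi, himax⟩ := s.exists_max_image (fun i => (P i).ord) hs
  obtain ⟨j, hj, hjmax⟩ := t.exists_max_image (fun j => (P j).ord) ht
  have hlt : ∀ i' j', (P i').ord + (P j').ord < (P i).ord + (P j).ord →
      ((a i' * b j') • (P i' * P j')).coeff ((P i).ord + (P j).ord) = 0 := by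
    intro i' j' hlt
    rw [coeff_smul, coeff_mul_eq_zero (fun _ => coeff_eq_zero_of_ord_lt)
      (fun _ => coeff_eq_zero_of_ord_lt) hlt, mul_zero]
  refine ne_zero_of_coeff_ne_zero (n := (P i).ord + (P j).ord) ?_
  rw [coeff_sum, Finset.sum_eq_single_of_mem i hi, coeff_sum, Finset.sum_eq_single_of_mem j hj,
    coeff_smul, coeff_mul_ord]
  · exact mul_ne_zero (mul_ne_zero (ha i hi) (hb j hj))
      (mul_ne_zero (lc_ne_zero (h0 i)) (lc_ne_zero (h0 j)))
  · intro j' hj' hne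
    have := lt_of_le_of_ne (hjmax j' hj') fun h => hne (hP h)
    exact hlt _ _ (by omega)
  · intro i' hi' hne
    have := lt_of_le_of_ne (himax i' hi') fun h => hne (hP h)
    rw [coeff_sum]
    exact Finset.sum_eq_zero fun j' hj' => hlt _ _ (by have := hjmax j' hj'; omega)

theorem isPrime_span_BCExt [CharZero K] {L A₁ A₂ : DiffOp K} (hL : L.ord = 3)
    (h : L.IsCentralizerBasis A₁ A₂) (h₁ : Commute L A₁) (h₂ : Commute L A₂)
    (h₁₂ : Commute A₁ A₂) : (Ideal.span (L.BCExt A₁ A₂)).IsPrime := by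
  obtain ⟨S, p, hp0, hp, hS⟩ := exists_span_eval_ord hL h h₁ h₂ h₁₂
  refine ⟨fun htop => ?_, fun {f g} hfg => ?_⟩
  · have h1 := evalK_eq_zero_of_mem_span h₁ h₂ h₁₂ ((Ideal.eq_top_iff_one _).mp htop)
    rw [← map_one (MvPolynomial.map (constants K).subtype), evalK_map, eval_one] at h1
    exact one_ne_zero h1
  · by_contra! hc
    obtain ⟨a, ha⟩ := hS f
    obtain ⟨b, hb⟩ := hS g
    have hne : ∀ (f : MvPolynomial (Fin 3) K) (a : S →₀ K),
        f ∉ Ideal.span (L.BCExt A₁ A₂) →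
        f - ∑ s ∈ a.support, a s • MvPolynomial.map (constants K).subtype (p s) ∈
          Ideal.span (L.BCExt A₁ A₂) → a.support.Nonempty := by
      intro f a hf ha
      by_contra hemp
      rw [Finset.not_nonempty_iff_eq_empty.mp hemp, Finset.sum_empty, sub_zero] at ha
      exact hf ha
    -- With z and w the reduced forms of f and g, fg − ((f − z)g + z(g − w)) = zw, so zw lies in the
    -- ideal.
    have hprod := Ideal.sub_mem _ hfg
      (Ideal.add_mem _ (Ideal.mul_mem_right g _ ha)
        (Ideal.mul_mem_left _ (∑ s ∈ a.support,
          a s • MvPolynomial.map (constants K).subtype (p s)) hb))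
    have h0 := evalK_eq_zero_of_mem_span h₁ h₂ h₁₂ hprod
    rw [show ∀ x y z w : MvPolynomial (Fin 3) K, x * y - ((x - z) * y + z * (y - w)) = z * w from
      fun x y z w => by ring, Finset.sum_mul_sum] at h0
    simp only [map_sum, smul_mul_smul_comm, map_smul, ← map_mul, evalK_map,
      eval_mul h₁ h₂ h₁₂] at h0
    refine sum_sum_smul_mul_ne_zero hp0 (fun s t hst => Subtype.ext ?_) (hne f a hc.1 ha)
      (hne g b hc.2 hb) (fun _ => Finsupp.mem_support_iff.mp) (fun _ => Finsupp.mem_support_iff.mp)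
      h0
    simpa only [hp] using hst

end DiffOp
-- Assembly of the main theorem.
theorem mainTheorem5 {K : Type*} [Field K] [Differential K] [CharZero K]
    [IsAlgClosed (constants K)] (L : DiffOp K) (hL : L.order = 3) (hLc : ¬ L.HasConstCoeffs)
    (hZ : L.centralizer ≠ L.constPoly) :
    (∃ A₁ A₂ : DiffOp K, L.IsCentralizerBasis A₁ A₂) ∧
    ∀ A₁ A₂ : DiffOp K, L.IsCentralizerBasis A₁ A₂ →
      -- `e_L` is a ring homomorphism
      (∀ f g, L.eval A₁ A₂ (f * g) = L.eval A₁ A₂ f * L.eval A₁ A₂ g) ∧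
      -- `[BC(L)]` is the ideal generated by `BC(L)`, it is a differential ideal, and it is prime
      L.BCIdeal A₁ A₂ = Ideal.span (L.BCExt A₁ A₂) ∧
      IsDifferentialIdeal (L.BCIdeal A₁ A₂) ∧
      (L.BCIdeal A₁ A₂).IsPrime ∧
      -- the kernel of `ε_L` is `[BC(L)]`
      (∀ g, L.evalK A₁ A₂ g = 0 ↔ g ∈ L.BCIdeal A₁ A₂) ∧
      -- `K[Γ]` is a differential domain
      IsDomain (L.CurveRing A₁ A₂) ∧
      (∃! δ : Derivation ℤ (L.CurveRing A₁ A₂) (L.CurveRing A₁ A₂),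
        ∀ q, δ (Ideal.Quotient.mk _ q) = Ideal.Quotient.mk _ (polyDeriv K q)) ∧
      -- `K(Γ)` is a differential field
      IsField (L.CurveField A₁ A₂) ∧
      (∃! δ : Derivation ℤ (L.CurveField A₁ A₂) (L.CurveField A₁ A₂),
        ∀ q, δ (algebraMap _ _ (Ideal.Quotient.mk (L.BCIdeal A₁ A₂) q)) =
          algebraMap _ _ (Ideal.Quotient.mk (L.BCIdeal A₁ A₂) (polyDeriv K q))) := by
  have hord : L.ord = 3 := DiffOp.ord_eq_of_order_eq hL
  refine ⟨?_, fun A₁ A₂ h => ?_⟩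
  · obtain ⟨A₁, A₂, h, -⟩ := DiffOp.exists_isCentralizerBasis hord hZ
    exact ⟨A₁, A₂, h⟩
  have hA₁ := h.mem_centralizer_left
  have hA₂ := h.mem_centralizer_right
  have h₁ : Commute L A₁ := DiffOp.mem_centralizer.mp hA₁
  have h₂ : Commute L A₂ := DiffOp.mem_centralizer.mp hA₂
  -- The given basis need not be the one built from minimal orders; commutativity of the whole
  -- centralizer covers it.
  have h₁₂ := DiffOp.commute_of_mem_centralizer hord hZ hA₁ hA₂
  have hdiff : IsDifferentialIdeal (Ideal.span (L.BCExt A₁ A₂)) :=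
    isDifferentialIdeal_span (by rintro _ ⟨g, -, rfl⟩; exact polyDeriv_map_constants g)
  have hspan : L.BCIdeal A₁ A₂ = Ideal.span (L.BCExt A₁ A₂) := differentialSpan_eq_span hdiff
  have hprime : (L.BCIdeal A₁ A₂).IsPrime :=
    hspan ▸ DiffOp.isPrime_span_BCExt hord h h₁ h₂ h₁₂
  have hdiff' : IsDifferentialIdeal (L.BCIdeal A₁ A₂) := hspan ▸ hdiff
  obtain ⟨δ, hδ, hδu⟩ := Derivation.existsUnique_quotient (polyDeriv K) (L.BCIdeal A₁ A₂) hdiff'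
  have hdom : IsDomain (L.CurveRing A₁ A₂) := Ideal.Quotient.isDomain _
  refine ⟨DiffOp.eval_mul h₁ h₂ h₁₂, hspan, hdiff', hprime,
    fun g => hspan ▸ DiffOp.mem_span_BCExt_iff hord h h₁ h₂ h₁₂ g, hdom, ⟨δ, hδ, hδu⟩,
    Field.toIsField (FractionRing (L.CurveRing A₁ A₂)), ?_⟩
  obtain ⟨η, hη, hηu⟩ := Derivation.existsUnique_isFractionRing_int (F := L.CurveField A₁ A₂) δ
  refine ⟨η, fun q => (hη _).trans (congrArg _ (hδ q)), fun η' hη' => hηu η' fun a => ?_⟩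
  obtain ⟨q, rfl⟩ := Ideal.Quotient.mk_surjective a
  exact (hη' q).trans (congrArg _ (hδ q).symm)
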